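/- There are $n$ agents and $m$ divisible resources of unit capacity. Agent $i$ has a demand vector $d_i=(d_{i1},\dots,d_{im})\in[0,1]^m$ with $d_{ir}=1$ for some $r$, and an amount of work $k_i>0$. An allocation assigns to each time $t\ge 0$ and agent $i$ a vector $A_i(t)=\lambda_i(t)d_i$ with $\lambda_i(t)\ge 0$ (the dominant share of agent $i$), such that $\sum_i A_{ir}(t)\le 1$ for every resource $r$ and the integrals below exist. The completion time $t_i$ of agent $i$ is the first time with $\int_0^{t_i}A_i(t)\,dt=k_id_i$ (it is infinite if there is no such time). An LCP (least cost product) allocation is an allocation that minimizes $\prod_i t_i$ among all allocations. An allocation is fixed if it is constant on each interval $[a,b)$, where $a$ is $0$ or a completion time and $b$ is the least completion time greater than $a$. For a set $S$ of agents let $P_S=\{\lambda\in\mathbb{R}_{\ge0}^S:\sum_{i\in S}\lambda_id_{ir}\le 1\text{ for every resource } r\}$; its Pareto frontier is the set of its maximal points for the componentwise order, and an extreme point of the Pareto frontier is an extreme point of $P_S$ that lies on the Pareto frontier. Theorem. For every LCP allocation there is a fixed LCP allocation with the same completion times. Every fixed LCP allocation consists of at most $n$ time interval allocations: there are $N\le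 n$ and $0=\tau_0<\tau_1<\dots<\tau_N$, where $\tau_1,\dots,\tau_N$ are the distinct completion times, such that the allocation is constant on each $[\tau_{p-1},\tau_p)$. Unless two agents tie in completion time, for each $p$ the dominant shares in the interval $[\tau_{p-1},\tau_p)$ of the set $S$ of agents that are unfinished in it (those with $t_i>\tau_{p-1}$) form an extreme point of the Pareto frontier of $P_S$; for a given interval this holds as soon as no two agents of its set $S$ tie. -/

import Mathlib

open MeasureTheory Set

noncomputable section

/-- `M` is an instantaneous allocation for the demand matrix `D`: no resource is used beyond its
unit capacity, and agent `i` receives a nonnegative multiple of its demand vector. -/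
def IsInstantaneousAllocation {n m : ℕ} (D M : Fin n → Fin m → ℝ) : Prop :=
  (∀ r, ∑ i, M i r ≤ 1) ∧ ∀ i, ∃ c : ℝ, 0 ≤ c ∧ ∀ r, M i r = c * D i r

/-- `A` is an allocation over time (only the times `t ≥ 0` matter): the integrals that measure
the consumed resources make sense, and at each time there is an instantaneous allocation. -/
structure IsAllocation {n m : ℕ} (D : Fin n → Fin m → ℝ) (A : ℝ → Fin n → Fin m → ℝ) : Prop where
  integrable : ∀ i r t, 0 ≤ t → IntervalIntegrable (fun s => A s i r) volume 0 t
  instantaneous : ∀ t, 0 ≤ t → IsInstantaneousAllocation D (A t)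

/-- `t` is the completion time (the cost) of agent `i`, whose job has the resource vector
`k i • D i`: the first time at which the integral of the agent's allocation equals that vector. -/
def IsCompletionTime {n m : ℕ} (D : Fin n → Fin m → ℝ) (k : Fin n → ℝ)
    (A : ℝ → Fin n → Fin m → ℝ) (i : Fin n) (t : ℝ) : Prop :=
  IsLeast {t : ℝ | 0 ≤ t ∧ ∀ r, ∫ s in (0 : ℝ)..t, A s i r = k i * D i r} t

/-- `A` is an allocation in which every agent completes its job, agent `i` at time `T i`. -/
structure IsCompletedAllocation {n m : ℕ} (D : Fin n → Fin m → ℝ) (k : Fin n → ℝ)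
    (A : ℝ → Fin n → Fin m → ℝ) (T : Fin n → ℝ) : Prop where
  isAllocation : IsAllocation D A
  completes : ∀ i, IsCompletionTime D k A i (T i)

/-- `A` is a least cost product allocation, with completion times `T`. An allocation that leaves
some job unfinished has infinite cost, so it is enough to compare with those that finish all. -/
def IsLCP {n m : ℕ} (D : Fin n → Fin m → ℝ) (k : Fin n → ℝ)
    (A : ℝ → Fin n → Fin m → ℝ) (T : Fin n → ℝ) : Prop :=
  IsCompletedAllocation D k A T ∧
    ∀ B T', IsCompletedAllocation D k B T' → ∏ i, T i ≤ ∏ i, T' i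

/-- `A` is constant on each interval `[a, b)`, where `a` is `0` or a completion time, and `b` is
the least completion time after `a`. -/
def IsFixed {n m : ℕ} (A : ℝ → Fin n → Fin m → ℝ) (T : Fin n → ℝ) : Prop :=
  ∀ a ∈ insert 0 (range T), ∀ b, IsLeast {t ∈ range T | a < t} b →
    ∀ s ∈ Ico a b, ∀ t ∈ Ico a b, A s = A t

/-- The resource-capacity polytope of a set `S` of agents, in terms of the dominant shares `x i`;
the agents outside `S` take no part. -/
def capacityPolytope {n m : ℕ} (D : Fin n → Fin m → ℝ) (S : Set (Fin n)) : Set (Fin n → ℝ) :=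
  {x | (∀ i, 0 ≤ x i) ∧ (∀ i, i ∉ S → x i = 0) ∧ ∀ r, ∑ i, x i * D i r ≤ 1}

/-- The Pareto frontier of the capacity polytope: its maximal points for the componentwise
order. -/
def paretoFrontier {n m : ℕ} (D : Fin n → Fin m → ℝ) (S : Set (Fin n)) : Set (Fin n → ℝ) :=
  {x | Maximal (· ∈ capacityPolytope D S) x}

/-- The extreme points of the Pareto frontier: the extreme points of the polytope that lie on its
Pareto frontier. -/
def paretoExtremePoints {n m : ℕ} (D : Fin n → Fin m → ℝ) (S : Set (Fin n)) :
    Set (Fin n → ℝ) :=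
  paretoFrontier D S ∩ (capacityPolytope D S).extremePoints ℝ

end

/-! Every claim comes from comparing the LCP allocation with a step schedule that does at least the
required work by the breakpoints; `IsLCP.prod_le` gives the resulting inequality between products.
Averaging the shares over each interval between consecutive completion times keeps the capacity
constraints and the work done by each breakpoint, so fixed LCP allocations exist. A dominating point
in one interval would do surplus work for some unfinished agent and lower the product, so the shares
are Pareto maximal.

For extremality, write the shares in interval `p` as a proper convex combination of `u` and `v`. The
changes of the interval lengths from `p` on, together with the amount of `u - v` added in `p`, give
one more unknown than there are work equations for the unfinished agents, hence a nonzero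
work-preserving direction. Small moves both ways along it change the completion times to `T i ± g
i`. Neither product may drop, but `(T i + g i) * (T i - g i) = T i ^ 2 - g i ^ 2`, so `g = 0`.
Without ties all lengths are then unchanged, and what remains of the direction forces `u = v`. -/

/-! ### Completed allocations from shares that do enough work -/

/-- The accumulated work is continuous in time, so it reaches `k i` by `T i`, and the times in `[0,
T i]` at which it equals `k i` form a compact set, which has a least element. Competitors thus need
only do enough work, not exactly the required amount. -/
theorem exists_isCompletedAllocation_le {n m : ℕ} {D : Fin n → Fin m → ℝ} {k : Fin n → ℝ}
    (hD_one : ∀ i, ∃ r, D i r = 1) (hk : ∀ i, 0 < k i) {c : ℝ → Fin n → ℝ}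
    (hint : ∀ i t, 0 ≤ t → IntervalIntegrable (fun s => c s i) volume 0 t)
    (hc : ∀ t, 0 ≤ t → c t ∈ capacityPolytope D univ) {T : Fin n → ℝ} (hT : ∀ i, 0 ≤ T i)
    (hw : ∀ i, k i ≤ ∫ s in (0 : ℝ)..T i, c s i) :
    ∃ T' : Fin n → ℝ, IsCompletedAllocation D k (fun t i r => c t i * D i r) T' ∧
      ∀ i, 0 < T' i ∧ T' i ≤ T i ∧ ∫ s in (0 : ℝ)..T' i, c s i = k i := by
  have key : ∀ i, ∃ t, IsLeast {t : ℝ | t ∈ Icc 0 (T i) ∧ ∫ s in (0 : ℝ)..t, c s i = k i} t := by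
    intro i
    have hcont : ContinuousOn (fun t => ∫ s in (0 : ℝ)..t, c s i) (Icc 0 (T i)) := by
      have := intervalIntegral.continuousOn_primitive_interval (μ := volume)
        (f := fun s => c s i) (a := 0) (b := T i)
        ((intervalIntegrable_iff' (by simp)).1 (hint i (T i) (hT i)))
      rwa [uIcc_of_le (hT i)] at this
    have hcl : IsClosed {t : ℝ | t ∈ Icc 0 (T i) ∧ ∫ s in (0 : ℝ)..t, c s i = k i} :=
      hcont.preimage_isClosed_of_isClosed isClosed_Icc (isClosed_singleton (x := k i))
    have hcomp : IsCompact {t : ℝ | t ∈ Icc 0 (T i) ∧ ∫ s in (0 : ℝ)..t, c s i = k i} :=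
      isCompact_Icc.of_isClosed_subset hcl fun t ht => ht.1
    refine hcomp.exists_isLeast ?_
    have := intermediate_value_Icc (hT i) hcont
    obtain ⟨t, ht, h⟩ := this (show k i ∈ _ from ⟨by simpa using (hk i).le, hw i⟩)
    exact ⟨t, ht, h⟩
  choose T' hT' using key
  refine ⟨T', ⟨⟨fun i r t ht => (hint i t ht).mul_const _, fun t ht => ⟨fun r => (hc t ht).2.2 r,
    fun i => ⟨c t i, (hc t ht).1 i, fun r => rfl⟩⟩⟩, fun i => ⟨⟨(hT' i).1.1.1, fun r => ?_⟩, ?_⟩⟩,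
    fun i => ⟨lt_of_le_of_ne (hT' i).1.1.1 ?_, (hT' i).1.1.2, (hT' i).1.2⟩⟩
  · rw [intervalIntegral.integral_mul_const, (hT' i).1.2]
  · rintro t ⟨ht0, ht⟩
    rcases le_or_gt t (T i) with h | h
    -- A resource with demand `1` turns the vector equation into the scalar one.
    · obtain ⟨r, hr⟩ := hD_one i
      refine (hT' i).2 ⟨⟨ht0, h⟩, ?_⟩
      simpa [hr] using ht r
    · exact (hT' i).1.1.2.trans h.le
  · intro h
    have := (hT' i).1.2
    rw [← h, intervalIntegral.integral_same] at this
    exact (hk i).ne this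

/-! ### Step schedules and breakpoints -/

/-- The shares that are constantly `x q` on `[τ q, τ (q + 1))` for `q < N`, and `0` elsewhere. -/
noncomputable def stepShares {n : ℕ} (N : ℕ) (τ : ℕ → ℝ) (x : ℕ → Fin n → ℝ) (t : ℝ) (i : Fin n) :
    ℝ :=
  ∑ q ∈ Finset.range N, (Ico (τ q) (τ (q + 1))).indicator (fun _ => x q i) t

theorem stepShares_eq {n N : ℕ} {τ : ℕ → ℝ} (hτ : StrictMono τ) (x : ℕ → Fin n → ℝ) {q : ℕ}
    (hq : q < N) {t : ℝ} (ht : t ∈ Ico (τ q) (τ (q + 1))) : stepShares N τ x t = x q := by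
  ext i
  unfold stepShares
  rw [Finset.sum_eq_single_of_mem q (Finset.mem_range.2 hq), indicator_of_mem ht]
  intro q' _ hne
  refine indicator_of_notMem (fun h => hne ?_) _
  have h1 := hτ.lt_iff_lt.1 (ht.1.trans_lt h.2)
  have h2 := hτ.lt_iff_lt.1 (h.1.trans_lt ht.2)
  omega

theorem stepShares_mem_capacityPolytope {n m N : ℕ} {D : Fin n → Fin m → ℝ} {τ : ℕ → ℝ}
    (hτ : StrictMono τ) {x : ℕ → Fin n → ℝ} (hx : ∀ q < N, x q ∈ capacityPolytope D univ) (t : ℝ) :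
    stepShares N τ x t ∈ capacityPolytope D univ := by
  by_cases h : ∃ q < N, t ∈ Ico (τ q) (τ (q + 1))
  · obtain ⟨q, hq, ht⟩ := h
    rw [stepShares_eq hτ x hq ht]
    exact hx q hq
  · have : stepShares N τ x t = 0 := by
      ext i
      refine Finset.sum_eq_zero fun q hq => indicator_of_notMem (fun ht => h ⟨q, ?_, ht⟩) _
      exact Finset.mem_range.1 hq
    rw [this]
    simp [capacityPolytope]

theorem intervalIntegrable_stepShares {n : ℕ} (N : ℕ) (τ : ℕ → ℝ) (x : ℕ → Fin n → ℝ) (i : Fin n)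
    (a b : ℝ) : IntervalIntegrable (fun s => stepShares N τ x s i) volume a b := by
  unfold stepShares
  have : ∀ q ∈ Finset.range N, IntervalIntegrable
      (fun s => (Ico (τ q) (τ (q + 1))).indicator (fun _ => x q i) s) volume a b := by
    intro q _
    rw [intervalIntegrable_iff]
    exact (intervalIntegrable_iff.1 intervalIntegrable_const).indicator measurableSet_Ico
  simpa [Finset.sum_fn] using IntervalIntegrable.sum _ this

theorem integral_eq_sum_of_eqOn {f : ℝ → ℝ} {τ : ℕ → ℝ} (hτ : StrictMono τ) {y : ℕ → ℝ} {M : ℕ}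
    (hf : ∀ q < M, IntervalIntegrable f volume (τ q) (τ (q + 1)))
    (h : ∀ q < M, ∀ t ∈ Ico (τ q) (τ (q + 1)), f t = y q) :
    ∫ s in τ 0..τ M, f s = ∑ q ∈ Finset.range M, (τ (q + 1) - τ q) * y q := by
  rw [← intervalIntegral.sum_integral_adjacent_intervals hf]
  refine Finset.sum_congr rfl fun q hq => ?_
  have hle : τ q ≤ τ (q + 1) := hτ.monotone (Nat.le_succ q)
  have : ∫ s in τ q..τ (q + 1), f s = ∫ _ in τ q..τ (q + 1), y q := by
    rw [intervalIntegral.integral_of_le hle, intervalIntegral.integral_of_le hle,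
      ← integral_Ico_eq_integral_Ioc, ← integral_Ico_eq_integral_Ioc]
    exact setIntegral_congr_fun measurableSet_Ico fun t ht => h q (Finset.mem_range.1 hq) t ht
  rw [this, intervalIntegral.integral_const, smul_eq_mul]

theorem integral_stepShares {n N M : ℕ} (hM : M ≤ N) {τ : ℕ → ℝ} (hτ : StrictMono τ)
    (hτ0 : τ 0 = 0) (x : ℕ → Fin n → ℝ) (i : Fin n) :
    ∫ s in (0 : ℝ)..τ M, stepShares N τ x s i
      = ∑ q ∈ Finset.range M, (τ (q + 1) - τ q) * x q i := by
  rw [← hτ0]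
  exact integral_eq_sum_of_eqOn hτ (fun q _ => intervalIntegrable_stepShares N τ x i _ _)
    fun q hq t ht => by rw [stepShares_eq hτ x (hq.trans_le hM) ht]

/-- The completion times `T` are enumerated increasingly by `τ 1, …, τ N`. -/
structure IsBreakpoints {n : ℕ} (T : Fin n → ℝ) (N : ℕ) (τ : ℕ → ℝ) (f : Fin n → ℕ) : Prop where
  strictMono : StrictMono τ
  zero : τ 0 = 0
  eq_time : ∀ i, τ (f i) = T i
  pos : ∀ i, 0 < f i
  le : ∀ i, f i ≤ N
  exists_eq : ∀ q, 0 < q → q ≤ N → ∃ i, f i = q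

theorem exists_isBreakpoints {n : ℕ} {T : Fin n → ℝ} (hT : ∀ i, 0 < T i) :
    ∃ N ≤ n, ∃ τ f, IsBreakpoints T N τ f := by
  classical
  set F : Finset ℝ := Finset.univ.image T with hF
  have h0 : (0 : ℝ) ∉ F := by
    simp only [hF, Finset.mem_image, Finset.mem_univ, true_and, not_exists]
    exact fun i => (hT i).ne'
  have hcard : (insert 0 F).card = F.card + 1 := Finset.card_insert_of_notMem h0
  have hN : F.card ≤ n := Finset.card_image_le.trans (by simp)
  generalize F.card = N at hcard hN
  let e := (insert 0 F).orderEmbOfFin hcard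
  have hrange : range e = insert 0 (range T) := by
    rw [Finset.range_orderEmbOfFin]
    simp [hF]
  have he0 : e 0 = 0 := by
    have hmem : (0 : ℝ) ∈ range e := by rw [hrange]; exact mem_insert _ _
    obtain ⟨j, hj⟩ := hmem
    have h1 : e 0 ≤ 0 := hj ▸ e.monotone (Fin.zero_le j)
    have h2 : e 0 ∈ insert 0 (range T) := hrange ▸ mem_range_self 0
    rcases h2 with h2 | ⟨i, hi⟩
    · exact h2
    · linarith [hT i]
  -- The values past `N` only serve to keep `τ` strictly monotone on all of `ℕ`.
  let τ : ℕ → ℝ := fun q => if h : q < N + 1 then e ⟨q, h⟩ else e (Fin.last N) + q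
  have hτe : ∀ (q : ℕ) (h : q < N + 1), τ q = e ⟨q, h⟩ := fun q h => dif_pos h
  have hTe : ∀ i, ∃ j : Fin (N + 1), e j = T i := fun i => by
    have : T i ∈ range e := hrange ▸ Or.inr (mem_range_self i)
    exact this
  choose g hg using hTe
  refine ⟨N, hN, τ, fun i => g i, ⟨?_, ?_, fun i => ?_, fun i => ?_, fun i => ?_, ?_⟩⟩
  · refine strictMono_nat_of_lt_succ fun q => ?_
    by_cases h1 : q + 1 < N + 1
    · rw [hτe q (by omega), hτe _ h1]
      exact e.strictMono (by simp [Fin.lt_def])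
    · have h2 : τ (q + 1) = e (Fin.last N) + ((q + 1 : ℕ) : ℝ) := dif_neg h1
      rw [h2]
      by_cases h3 : q < N + 1
      · rw [hτe q h3]
        have := e.monotone (Fin.le_last ⟨q, h3⟩)
        have : (0 : ℝ) < ((q + 1 : ℕ) : ℝ) := by positivity
        linarith
      · have h4 : τ q = e (Fin.last N) + (q : ℝ) := dif_neg h3
        rw [h4]
        push_cast
        linarith
  · rw [hτe 0 (by omega)]
    exact he0
  · rw [hτe _ (g i).2]
    exact hg i
  · rcases Nat.eq_zero_or_pos (g i) with h | h
    · have : g i = 0 := Fin.ext h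
      have h2 := hg i
      rw [this, he0] at h2
      exact absurd h2 (hT i).ne
    · exact h
  · exact Nat.lt_succ_iff.1 (g i).2
  · intro q hq hqN
    have : e ⟨q, by omega⟩ ∈ insert 0 (range T) := hrange ▸ mem_range_self _
    rcases this with h | ⟨i, hi⟩
    · rw [← he0] at h
      have := congrArg Fin.val (e.injective h)
      simp at this
      omega
    · exact ⟨i, congrArg Fin.val (e.injective ((hg i).trans hi))⟩

/-! ### Minimality of the product and fixed LCP allocations -/

theorem IsLCP.time_pos {n m : ℕ} {D : Fin n → Fin m → ℝ} {k : Fin n → ℝ}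
    {A : ℝ → Fin n → Fin m → ℝ} {T : Fin n → ℝ} (hD_one : ∀ i, ∃ r, D i r = 1)
    (hk : ∀ i, 0 < k i) (h : IsLCP D k A T) (i : Fin n) : 0 < T i := by
  obtain ⟨⟨h0, hr⟩, -⟩ := h.1.completes i
  refine lt_of_le_of_ne h0 fun h => ?_
  obtain ⟨r, hr1⟩ := hD_one i
  have := hr r
  rw [← h, intervalIntegral.integral_same, hr1, mul_one] at this
  exact (hk i).ne this

theorem IsAllocation.exists_shares {n m : ℕ} {D : Fin n → Fin m → ℝ} {A : ℝ → Fin n → Fin m → ℝ}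
    (hD_one : ∀ i, ∃ r, D i r = 1) (h : IsAllocation D A) :
    ∃ ρ : Fin n → Fin m, (∀ i, D i (ρ i) = 1) ∧ ∀ t, 0 ≤ t →
      (∀ i r, A t i r = A t i (ρ i) * D i r) ∧
      (fun i => A t i (ρ i)) ∈ capacityPolytope D univ := by
  choose ρ hρ using hD_one
  refine ⟨ρ, hρ, fun t ht => ?_⟩
  obtain ⟨h1, h2⟩ := h.instantaneous t ht
  have h3 : ∀ i r, A t i r = A t i (ρ i) * D i r := fun i r => by
    obtain ⟨c, -, hc⟩ := h2 i
    rw [hc, hc, hρ, mul_one]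
  refine ⟨h3, fun i => ?_, fun i hi => absurd (mem_univ i) hi, fun r => ?_⟩
  · obtain ⟨c, hc0, hc⟩ := h2 i
    simpa [hc, hρ] using hc0
  · simpa only [← h3] using h1 r

/-- A schedule that does at least the required work by the times `T'` costs at least as much as a
least cost product allocation, and strictly more if it does too much work for some agent. -/
theorem IsLCP.prod_le {n m : ℕ} {D : Fin n → Fin m → ℝ} {k : Fin n → ℝ}
    {A : ℝ → Fin n → Fin m → ℝ} {T : Fin n → ℝ} (hD_one : ∀ i, ∃ r, D i r = 1)
    (hk : ∀ i, 0 < k i) (h : IsLCP D k A T) {N : ℕ} {τ : ℕ → ℝ} (hτ : StrictMono τ)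
    (hτ0 : τ 0 = 0) {x : ℕ → Fin n → ℝ} (hx : ∀ q < N, x q ∈ capacityPolytope D univ)
    {f : Fin n → ℕ} (hf : ∀ i, f i ≤ N)
    (hw : ∀ i, k i ≤ ∑ q ∈ Finset.range (f i), (τ (q + 1) - τ q) * x q i) :
    ∏ i, T i ≤ ∏ i, τ (f i) ∧
      ∀ i, k i < ∑ q ∈ Finset.range (f i), (τ (q + 1) - τ q) * x q i →
        ∏ i, T i < ∏ i, τ (f i) := by
  have hpos : ∀ q, 0 ≤ τ q := fun q => hτ0 ▸ hτ.monotone (Nat.zero_le q)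
  obtain ⟨T', hT', hle⟩ := exists_isCompletedAllocation_le hD_one hk
    (fun i t _ => intervalIntegrable_stepShares N τ x i 0 t)
    (fun t _ => stepShares_mem_capacityPolytope hτ hx t) (T := fun i => τ (f i))
    (fun i => hpos _) (fun i => (hw i).trans_eq (integral_stepShares (hf i) hτ hτ0 x i).symm)
  refine ⟨(h.2 _ T' hT').trans (Finset.prod_le_prod (fun i _ => (hle i).1.le)
    fun i _ => (hle i).2.1), fun i hi => (h.2 _ T' hT').trans_lt
    (Finset.prod_lt_prod (fun i _ => (hle i).1) (fun i _ => (hle i).2.1)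
      ⟨i, Finset.mem_univ i, lt_of_le_of_ne (hle i).2.1 fun heq => ?_⟩)⟩
  -- If agent `i` finished only at `τ (f i)`, its work by then would be exactly `k i`, not more.
  rw [← integral_stepShares (hf i) hτ hτ0 x i, ← heq, (hle i).2.2] at hi
  exact lt_irrefl _ hi

theorem IsLCP.exists_isFixed {n m : ℕ} {D : Fin n → Fin m → ℝ} {k : Fin n → ℝ}
    {A : ℝ → Fin n → Fin m → ℝ} {T : Fin n → ℝ} (hD_one : ∀ i, ∃ r, D i r = 1)
    (hk : ∀ i, 0 < k i) (h : IsLCP D k A T) : ∃ B, IsLCP D k B T ∧ IsFixed B T := by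
  obtain ⟨N, -, τ, f, hb⟩ := exists_isBreakpoints (h.time_pos hD_one hk)
  obtain ⟨ρ, hρ, hA⟩ := h.1.isAllocation.exists_shares hD_one
  have hτ := hb.strictMono
  have hpos : ∀ q, 0 ≤ τ q := fun q => hb.zero ▸ hτ.monotone (Nat.zero_le q)
  have hint : ∀ i r p q, IntervalIntegrable (fun s => A s i r) volume (τ p) (τ q) :=
    fun i r p q => (h.1.isAllocation.integrable i r _ (hpos p)).symm.trans
      (h.1.isAllocation.integrable i r _ (hpos q))
  -- The mean share over the interval: its product with the length is the work done there.
  let x : ℕ → Fin n → ℝ := fun q i =>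
    (τ (q + 1) - τ q)⁻¹ * ∫ s in τ q..τ (q + 1), A s i (ρ i)
  have hlen : ∀ q, 0 < τ (q + 1) - τ q := fun q => sub_pos.2 (hτ (Nat.lt_succ_self q))
  have hle : ∀ q, τ q ≤ τ (q + 1) := fun q => (hτ (Nat.lt_succ_self q)).le
  have hx : ∀ q < N, x q ∈ capacityPolytope D univ := by
    refine fun q _ => ⟨fun i => mul_nonneg (inv_nonneg.2 (hlen q).le) ?_,
      fun i hi => absurd (mem_univ i) hi, fun r => ?_⟩
    · exact intervalIntegral.integral_nonneg (hle q) fun t ht =>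
        (hA t ((hpos q).trans ht.1)).2.1 i
    · have h1 : ∑ i, x q i * D i r
          = (τ (q + 1) - τ q)⁻¹ * ∫ s in τ q..τ (q + 1), ∑ i, A s i (ρ i) * D i r := by
        rw [intervalIntegral.integral_finsetSum fun i _ => (hint i (ρ i) _ _).mul_const _,
          Finset.mul_sum]
        simp only [intervalIntegral.integral_mul_const, x, mul_assoc]
      have h2 : ∫ s in τ q..τ (q + 1), ∑ i, A s i (ρ i) * D i r
          ≤ ∫ _ in τ q..τ (q + 1), (1 : ℝ) := by
        refine intervalIntegral.integral_mono_on (hle q) ?_ intervalIntegrable_const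
          fun t ht => (hA t ((hpos q).trans ht.1)).2.2.2 r
        simpa [Finset.sum_fn] using
          IntervalIntegrable.sum Finset.univ fun i _ => (hint i (ρ i) _ _).mul_const (D i r)
      rw [intervalIntegral.integral_const, smul_eq_mul, mul_one] at h2
      rw [h1, inv_mul_le_iff₀ (hlen q), mul_one]
      exact h2
  have hw : ∀ i, k i ≤ ∫ s in (0 : ℝ)..T i, stepShares N τ x s i := by
    intro i
    rw [← hb.eq_time i, integral_stepShares (hb.le i) hτ hb.zero]
    have : ∀ q, (τ (q + 1) - τ q) * x q i = ∫ s in τ q..τ (q + 1), A s i (ρ i) :=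
      fun q => mul_inv_cancel_left₀ (hlen q).ne' _
    simp only [this]
    rw [intervalIntegral.sum_integral_adjacent_intervals fun q _ => hint i (ρ i) _ _, hb.zero,
      hb.eq_time, (h.1.completes i).1.2, hρ, mul_one]
  obtain ⟨T', hT', hle'⟩ := exists_isCompletedAllocation_le hD_one hk
    (fun i t _ => intervalIntegrable_stepShares N τ x i 0 t)
    (fun t _ => stepShares_mem_capacityPolytope hτ hx t)
    (fun i => (h.time_pos hD_one hk i).le) hw
  -- The averaged schedule finishes no later than `T`; finishing earlier anywhere would contradict
  -- minimality.
  have heq : T' = T := by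
    ext i
    by_contra hne
    exact absurd (h.2 _ T' hT') (not_le.2 (Finset.prod_lt_prod (fun i _ => (hle' i).1)
      (fun i _ => (hle' i).2.1) ⟨i, Finset.mem_univ i, lt_of_le_of_ne (hle' i).2.1 hne⟩))
  rw [heq] at hT'
  refine ⟨_, ⟨hT', h.2⟩, ?_⟩
  intro a ha b hab
  obtain ⟨q, hq⟩ : ∃ q, τ q = a := by
    rcases ha with rfl | ⟨i, rfl⟩
    · exact ⟨0, hb.zero⟩
    · exact ⟨f i, hb.eq_time i⟩
  obtain ⟨⟨i, hi⟩, hlt⟩ := hab.1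
  have hqi : q < f i := by
    rw [← hτ.lt_iff_lt, hq, hb.eq_time, hi]
    exact hlt
  have hqN : q < N := hqi.trans_le (hb.le i)
  have hb' : b ≤ τ (q + 1) := by
    obtain ⟨j, hj⟩ := hb.exists_eq (q + 1) (Nat.succ_pos q) hqN
    refine hab.2 ⟨⟨j, by rw [← hj, hb.eq_time]⟩, ?_⟩
    rw [← hq]
    exact hτ (Nat.lt_succ_self q)
  intro s hs t ht
  subst hq
  simp only [stepShares_eq hτ x hqN ⟨hs.1, hs.2.trans_le hb'⟩,
    stepShares_eq hτ x hqN ⟨ht.1, ht.2.trans_le hb'⟩]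
-- The capacity polytope and Pareto maximality
open scoped Topology

theorem convex_capacityPolytope {n m : ℕ} (D : Fin n → Fin m → ℝ) (S : Set (Fin n)) :
    Convex ℝ (capacityPolytope D S) := by
  intro u hu v hv a b ha hb hab
  refine ⟨fun i => ?_, fun i hi => ?_, fun r => ?_⟩
  · exact add_nonneg (mul_nonneg ha (hu.1 i)) (mul_nonneg hb (hv.1 i))
  · simp [hu.2.1 i hi, hv.2.1 i hi]
  · have : ∑ i, (a • u + b • v) i * D i r
        = a * ∑ i, u i * D i r + b * ∑ i, v i * D i r := by
      rw [Finset.mul_sum, Finset.mul_sum, ← Finset.sum_add_distrib]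
      exact Finset.sum_congr rfl fun i _ => by simp; ring
    rw [this, ← hab]
    exact add_le_add (mul_le_of_le_one_right ha (hu.2.2 r)) (mul_le_of_le_one_right hb (hv.2.2 r))

theorem capacityPolytope_subset_univ {n m : ℕ} (D : Fin n → Fin m → ℝ) (S : Set (Fin n)) :
    capacityPolytope D S ⊆ capacityPolytope D univ :=
  fun _ hx => ⟨hx.1, fun i hi => absurd (mem_univ i) hi, hx.2.2⟩

theorem indicator_mem_capacityPolytope {n m : ℕ} {D : Fin n → Fin m → ℝ}
    (hD : ∀ i r, 0 ≤ D i r) {x : Fin n → ℝ} (hx : x ∈ capacityPolytope D univ)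
    (S : Set (Fin n)) : S.indicator x ∈ capacityPolytope D S :=
  ⟨fun _ => indicator_nonneg (fun j _ => hx.1 j) _, fun _ hi => indicator_of_notMem hi _,
    fun r => (Finset.sum_le_sum fun i _ => mul_le_mul_of_nonneg_right
      (indicator_le_self' (fun j _ => hx.1 j) i) (hD i r)).trans (hx.2.2 r)⟩

/-- Putting a dominating `z` in place of `x p` keeps the breakpoints and gives surplus work to an
unfinished agent, so the strict part of `IsLCP.prod_le` yields a product smaller than itself. Ties
do no harm here. -/
theorem IsLCP.indicator_mem_paretoFrontier {n m : ℕ} {D : Fin n → Fin m → ℝ} {k : Fin n → ℝ}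
    {A : ℝ → Fin n → Fin m → ℝ} {T : Fin n → ℝ} (hD : ∀ i r, 0 ≤ D i r)
    (hD_one : ∀ i, ∃ r, D i r = 1) (hk : ∀ i, 0 < k i) (h : IsLCP D k A T) {N : ℕ} {τ : ℕ → ℝ}
    {f : Fin n → ℕ} (hb : IsBreakpoints T N τ f) {x : ℕ → Fin n → ℝ}
    (hx : ∀ q < N, x q ∈ capacityPolytope D univ)
    (hw : ∀ i, k i = ∑ q ∈ Finset.range (f i), (τ (q + 1) - τ q) * x q i) {p : ℕ} (hp : p < N) :
    indicator {i | p < f i} (x p) ∈ paretoFrontier D {i | p < f i} := by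
  refine ⟨indicator_mem_capacityPolytope hD (hx p hp) _, fun z hz hle => ?_⟩
  by_contra hnot
  obtain ⟨i, hi⟩ : ∃ i, indicator {i | p < f i} (x p) i < z i := by
    simpa [Pi.le_def] using hnot
  have hip : p < f i := by
    by_contra hip
    rw [indicator_of_notMem (by exact hip), hz.2.1 i hip] at hi
    exact lt_irrefl _ hi
  have hlen : ∀ q, 0 < τ (q + 1) - τ q := fun q => sub_pos.2 (hb.strictMono (Nat.lt_succ_self q))
  have hterm : ∀ i, ∀ q ∈ Finset.range (f i),
      (τ (q + 1) - τ q) * x q i ≤ (τ (q + 1) - τ q) * Function.update x p z q i := by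
    intro i q hq
    rcases eq_or_ne q p with rfl | hqp
    · have := hle i
      rw [indicator_of_mem (by exact Finset.mem_range.1 hq)] at this
      rw [Function.update_self]
      exact mul_le_mul_of_nonneg_left this (hlen q).le
    · rw [Function.update_of_ne hqp]
  have hprod := h.prod_le hD_one hk hb.strictMono hb.zero (x := Function.update x p z) (N := N)
    (fun q hq => by
      rcases eq_or_ne q p with rfl | hqp
      · rw [Function.update_self]
        exact capacityPolytope_subset_univ D _ hz
      · rw [Function.update_of_ne hqp]
        exact hx q hq) hb.le (fun i => (hw i).trans_le (Finset.sum_le_sum (hterm i)))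
  have hlt := hprod.2 i (by
    rw [hw i]
    refine Finset.sum_lt_sum (hterm i) ⟨p, Finset.mem_range.2 hip, ?_⟩
    rw [Function.update_self]
    rw [indicator_of_mem (by exact hip)] at hi
    exact mul_lt_mul_of_pos_left hi (hlen p))
  simp only [hb.eq_time] at hlt
  exact lt_irrefl _ hlt

/-! ### Perturbing the interval lengths: extremality -/

/-- Changing all factors of a positive product proportionally to `± s` makes it smaller for one of
the signs. -/
theorem eq_zero_of_prod_le_prod_add_of_prod_le_prod_sub {ι : Type*} [Fintype ι] {T g : ι → ℝ}
    (hT : ∀ i, 0 < T i) (hadd : ∀ i, 0 < T i + g i) (hsub : ∀ i, 0 < T i - g i)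
    (h1 : ∏ i, T i ≤ ∏ i, (T i + g i)) (h2 : ∏ i, T i ≤ ∏ i, (T i - g i)) (i : ι) : g i = 0 := by
  by_contra hi
  -- Multiplied together, the two inequalities bound the product of the `T i ^ 2` by that of the `T
  -- i ^ 2 - g i ^ 2`.
  have hle := mul_le_mul h1 h2 (Finset.prod_nonneg fun i _ => (hT i).le)
    (Finset.prod_nonneg fun i _ => (hadd i).le)
  rw [← Finset.prod_mul_distrib, ← Finset.prod_mul_distrib] at hle
  refine absurd hle (not_le.2 (Finset.prod_lt_prod (fun j _ => mul_pos (hadd j) (hsub j))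
    (fun j _ => ?_) ⟨i, Finset.mem_univ i, ?_⟩))
  · nlinarith [sq_nonneg (g j)]
  · nlinarith [sq_pos_of_ne_zero hi]

/-- The change of the length of the `q`-th interval when the interval in which agent `j` finishes
is changed by `β j`. -/
def lengthChange {n : ℕ} (f : Fin n → ℕ) {S : Set (Fin n)} [Fintype S] (β : S → ℝ) (q : ℕ) : ℝ :=
  ∑ j : S, if f j = q + 1 then β j else 0

theorem sum_lengthChange {n : ℕ} {f : Fin n → ℕ} (hf : ∀ i, 0 < f i) {S : Set (Fin n)} [Fintype S]
    (β : S → ℝ) (M : ℕ) :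
    ∑ q ∈ Finset.range M, lengthChange f β q = ∑ j : S, if f j ≤ M then β j else 0 := by
  unfold lengthChange
  rw [Finset.sum_comm]
  refine Finset.sum_congr rfl fun j _ => ?_
  have hj := hf j
  split_ifs with h
  · rw [Finset.sum_eq_single_of_mem (f j - 1) (Finset.mem_range.2 (by omega))]
    · rw [if_pos (by omega)]
    · exact fun q _ hq => if_neg (by omega)
  · exact Finset.sum_eq_zero fun q hq => if_neg (by have := Finset.mem_range.1 hq; omega)

/-- Without ties in `S` the system is triangular: the sum for `i` is `β i` plus the `β j` of agents
of `S` that finish strictly earlier. -/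
theorem eq_zero_of_sum_lengthChange_eq_zero {n : ℕ} {f : Fin n → ℕ} (hf : ∀ i, 0 < f i)
    {S : Set (Fin n)} [Fintype S] (hS : InjOn f S) {β : S → ℝ}
    (h : ∀ i ∈ S, ∑ q ∈ Finset.range (f i), lengthChange f β q = 0) : β = 0 := by
  have key : ∀ M, ∀ i : S, f i = M → β i = 0 := by
    intro M
    induction M using Nat.strong_induction_on with
    | _ M ih =>
      intro i hi
      have h1 := h i i.2
      rw [sum_lengthChange hf, Finset.sum_eq_single_of_mem i (Finset.mem_univ i), if_pos le_rfl]
        at h1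
      · exact h1
      · intro j _ hji
        split_ifs with hle
        · have hne : f j ≠ f i := fun he => hji (Subtype.ext (hS j.2 i.2 he))
          exact ih (f j) (by omega) j rfl
        · rfl
  exact funext fun i => key _ i rfl

/-- A dimension count: one unknown `β j` per agent of `S`, and `α`, against one equation per agent
of `S`. -/
theorem exists_work_preserving_change {n : ℕ} (f : Fin n → ℕ) (S : Set (Fin n)) [Fintype S]
    (x : ℕ → Fin n → ℝ) (w : Fin n → ℝ) :
    ∃ (α : ℝ) (β : S → ℝ), (α ≠ 0 ∨ β ≠ 0) ∧
      ∀ i ∈ S, ∑ q ∈ Finset.range (f i), lengthChange f β q * x q i + α * w i = 0 := by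
  have hadd : ∀ (β β' : S → ℝ) q, lengthChange f (β + β') q
      = lengthChange f β q + lengthChange f β' q := fun β β' q => by
    unfold lengthChange
    rw [← Finset.sum_add_distrib]
    exact Finset.sum_congr rfl fun j _ => by split_ifs <;> simp
  have hsmul : ∀ (c : ℝ) (β : S → ℝ) q, lengthChange f (c • β) q = c * lengthChange f β q :=
    fun c β q => by
    unfold lengthChange
    rw [Finset.mul_sum]
    exact Finset.sum_congr rfl fun j _ => by split_ifs <;> simp
  let Φ : (ℝ × (S → ℝ)) →ₗ[ℝ] (S → ℝ) :=
    { toFun := fun z i => ∑ q ∈ Finset.range (f i), lengthChange f z.2 q * x q i + z.1 * w i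
      map_add' := fun z z' => by
        ext i
        simp only [Prod.snd_add, Prod.fst_add, hadd, Pi.add_apply, add_mul,
          Finset.sum_add_distrib]
        ring
      map_smul' := fun c z => by
        ext i
        simp only [Prod.smul_snd, Prod.smul_fst, hsmul, Pi.smul_apply, smul_eq_mul, mul_add,
          Finset.mul_sum, mul_assoc, RingHom.id_apply] }
  have hker : LinearMap.ker Φ ≠ ⊥ := LinearMap.ker_ne_bot_of_finrank_lt (by simp)
  obtain ⟨z, hz, hz0⟩ := (Submodule.ne_bot_iff _).1 hker
  refine ⟨z.1, z.2, ?_, fun i hi => congrFun (LinearMap.mem_ker.1 hz) ⟨i, hi⟩⟩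
  by_contra! hcon
  exact hz0 (Prod.ext hcon.1 hcon.2)

theorem IsLCP.indicator_mem_extremePoints {n m : ℕ} {D : Fin n → Fin m → ℝ} {k : Fin n → ℝ}
    {A : ℝ → Fin n → Fin m → ℝ} {T : Fin n → ℝ} (hD : ∀ i r, 0 ≤ D i r)
    (hD_one : ∀ i, ∃ r, D i r = 1) (hk : ∀ i, 0 < k i) (h : IsLCP D k A T) {N : ℕ} {τ : ℕ → ℝ}
    {f : Fin n → ℕ} (hb : IsBreakpoints T N τ f) {x : ℕ → Fin n → ℝ}
    (hx : ∀ q < N, x q ∈ capacityPolytope D univ)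
    (hw : ∀ i, k i = ∑ q ∈ Finset.range (f i), (τ (q + 1) - τ q) * x q i) {p : ℕ} (hp : p < N)
    (hinj : InjOn f {i | p < f i}) :
    indicator {i | p < f i} (x p) ∈ (capacityPolytope D {i | p < f i}).extremePoints ℝ := by
  classical
  set S : Set (Fin n) := {i | p < f i} with hS
  set y : Fin n → ℝ := S.indicator (x p)
  refine ⟨indicator_mem_capacityPolytope hD (hx p hp) _, fun u hu v hv hyuv => ?_⟩
  obtain ⟨a, b, ha, hb0, hab, hyab⟩ := hyuv
  have hτ := hb.strictMono
  have hlen : ∀ q, 0 < τ (q + 1) - τ q := fun q => sub_pos.2 (hτ (Nat.lt_succ_self q))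
  obtain ⟨α, β, hne, hker⟩ := exists_work_preserving_change f S x (u - v)
  set γ : ℕ → ℝ := lengthChange f β with hγ
  have hγN : ∀ q, N ≤ q → γ q = 0 := fun q hq =>
    Finset.sum_eq_zero fun j _ => if_neg (by have := hb.le j; omega)
  -- Intervals before `p` keep their lengths, so agents already finished are unaffected.
  have hγp : ∀ q, q < p → γ q = 0 := fun q hq =>
    Finset.sum_eq_zero fun j _ => if_neg (by have : p < f j := j.2; omega)
  let τ' : ℝ → ℕ → ℝ := fun s q => τ q + s * ∑ j ∈ Finset.range q, γ j
  have hτ'len : ∀ s q, τ' s (q + 1) - τ' s q = τ (q + 1) - τ q + s * γ q := fun s q => by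
    simp only [τ', Finset.sum_range_succ]
    ring
  -- Dividing by the new length makes the work affine in `s`: the term in `u - v` contributes
  -- exactly `s * α * (u - v) i`.
  let x' : ℝ → ℕ → Fin n → ℝ := fun s =>
    Function.update x p (y + (s * α / (τ' s (p + 1) - τ' s p)) • (u - v))
  -- For small `s` the lengths stay positive and the new point stays a convex combination of `u` and
  -- `v`, because `a` and `b` are positive.
  have hev : ∀ᶠ s in 𝓝 (0 : ℝ), (∀ q ∈ Finset.range N, 0 < τ (q + 1) - τ q + s * γ q) ∧
      0 < a + s * α / (τ (p + 1) - τ p + s * γ p) ∧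
      0 < b - s * α / (τ (p + 1) - τ p + s * γ p) := by
    have hc : ContinuousAt (fun s : ℝ => s * α / (τ (p + 1) - τ p + s * γ p)) 0 :=
      ContinuousAt.div (by fun_prop) (by fun_prop) (by simpa using (hlen p).ne')
    refine ((Finset.eventually_all _).2 fun q _ => ?_).and (Filter.Eventually.and ?_ ?_)
    · exact ContinuousAt.eventually_lt (f := fun _ : ℝ => (0 : ℝ))
        (g := fun s => τ (q + 1) - τ q + s * γ q) (by fun_prop) (by fun_prop)
        (by simpa using hlen q)
    · exact ContinuousAt.eventually_lt continuousAt_const (continuousAt_const.add hc)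
        (by simpa using ha)
    · exact ContinuousAt.eventually_lt continuousAt_const (continuousAt_const.sub hc)
        (by simpa using hb0)
  have hgood : ∀ᶠ s in 𝓝 (0 : ℝ), (∀ i, 0 < τ' s (f i)) ∧ ∏ i, T i ≤ ∏ i, τ' s (f i) := by
    filter_upwards [hev] with s hs
    obtain ⟨hs1, hs2, hs3⟩ := hs
    have hlen' : ∀ q, 0 < τ' s (q + 1) - τ' s q := fun q => by
      rw [hτ'len]
      by_cases hq : q < N
      · exact hs1 q (Finset.mem_range.2 hq)
      · rw [hγN q (not_lt.1 hq), mul_zero, add_zero]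
        exact hlen q
    have hmono : StrictMono (τ' s) := strictMono_nat_of_lt_succ fun q => sub_pos.1 (hlen' q)
    have h0 : τ' s 0 = 0 := by simp [τ', hb.zero]
    refine ⟨fun i => h0 ▸ hmono (hb.pos i), (h.prod_le hD_one hk hmono h0 (x := x' s) (N := N)
      (fun q hq => ?_) hb.le (fun i => ?_)).1⟩
    · rcases eq_or_ne q p with rfl | hqp
      · simp only [x', Function.update_self]
        rw [hτ'len]
        set c := s * α / (τ (q + 1) - τ q + s * γ q)
        have : y + c • (u - v) = (a + c) • u + (b - c) • v := by
          rw [← hyab]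
          module
        rw [this]
        exact capacityPolytope_subset_univ D _ (convex_capacityPolytope D S hu hv hs2.le hs3.le
          (by linarith))
      · simp only [x', Function.update_of_ne hqp]
        exact hx q hq
    · by_cases hi : i ∈ S
      · have hyi : y i = x p i := indicator_of_mem hi _
        have hterm : ∀ q, (τ' s (q + 1) - τ' s q) * x' s q i = (τ (q + 1) - τ q) * x q i
            + s * (γ q * x q i) + if q = p then s * (α * (u - v) i) else 0 := by
          intro q
          split_ifs with hqp
          · subst hqp
            simp only [x', Function.update_self, Pi.add_apply, Pi.smul_apply, smul_eq_mul, hyi]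
            rw [mul_add, ← mul_assoc, mul_div_cancel₀ _ (hlen' q).ne', hτ'len]
            ring
          · simp only [x', Function.update_of_ne hqp]
            rw [hτ'len]
            ring
        simp only [hterm, Finset.sum_add_distrib]
        rw [← hw i, ← Finset.mul_sum, Finset.sum_ite_eq' (Finset.range (f i)) p,
          if_pos (Finset.mem_range.2 hi), add_assoc, ← mul_add, hker i hi]
        simp
      · rw [hw i]
        refine le_of_eq (Finset.sum_congr rfl fun q hq => ?_)
        have hqp : q < p := (Finset.mem_range.1 hq).trans_le (not_lt.1 hi)
        simp only [x', Function.update_of_ne hqp.ne]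
        rw [hτ'len, hγp q hqp, mul_zero, add_zero]
  have hneg : ∀ᶠ s in 𝓝 (0 : ℝ), (∀ i, 0 < τ' (-s) (f i)) ∧ ∏ i, T i ≤ ∏ i, τ' (-s) (f i) := by
    have ht : Filter.Tendsto (fun s : ℝ => -s) (𝓝 0) (𝓝 0) := by
      simpa using (continuous_neg (G := ℝ)).tendsto 0
    exact ht.eventually hgood
  obtain ⟨s, ⟨hs1, hs2⟩, hs0⟩ := (((hgood.and hneg).filter_mono
    (nhdsWithin_le_nhds (s := Ioi 0))).and self_mem_nhdsWithin).exists
  have hsum : ∀ i, ∑ q ∈ Finset.range (f i), γ q = 0 := by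
    intro i
    have := eq_zero_of_prod_le_prod_add_of_prod_le_prod_sub (h.time_pos hD_one hk)
      (g := fun i => s * ∑ q ∈ Finset.range (f i), γ q)
      (fun i => by simpa [τ', hb.eq_time] using hs1.1 i)
      (fun i => by simpa [τ', hb.eq_time, sub_eq_add_neg] using hs2.1 i)
      (by simpa [τ', hb.eq_time] using hs1.2)
      (by simpa [τ', hb.eq_time, sub_eq_add_neg] using hs2.2) i
    exact (mul_eq_zero.1 this).resolve_left (ne_of_gt hs0)
  have hβ : β = 0 := eq_zero_of_sum_lengthChange_eq_zero hb.pos hinj fun i _ => hsum i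
  have hα : α ≠ 0 := hne.resolve_right (not_not.2 hβ)
  have hγ0 : ∀ q, γ q = 0 := fun q => by simp [hγ, lengthChange, hβ]
  have huv : u = v := by
    ext i
    by_cases hi : i ∈ S
    · have := hker i hi
      simp only [hγ0, zero_mul, Finset.sum_const_zero, zero_add, mul_eq_zero, hα, false_or,
        Pi.sub_apply] at this
      exact sub_eq_zero.1 this
    · rw [hu.2.1 i hi, hv.2.1 i hi]
  rw [← hyab, ← huv, ← add_smul, hab, one_smul]

/-! ### The theorem -/

theorem theorem4 (n m : ℕ) (D : Fin n → Fin m → ℝ) (k : Fin n → ℝ)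
    (hD : ∀ i r, 0 ≤ D i r ∧ D i r ≤ 1) (hD_one : ∀ i, ∃ r, D i r = 1) (hk : ∀ i, 0 < k i) :
    -- every LCP allocation has an equivalent fixed one
    (∀ A T, IsLCP D k A T → ∃ B, IsLCP D k B T ∧ IsFixed B T) ∧
    -- the structure of (fixed) LCP allocations
    (∀ A T, IsLCP D k A T → IsFixed A T →
      ∃ N : ℕ, N ≤ n ∧ ∃ (τ : Fin (N + 1) → ℝ) (x : Fin N → Fin n → ℝ),
        StrictMono τ ∧ τ 0 = 0 ∧ Set.range τ = insert 0 (Set.range T) ∧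
        (∀ p, ∀ t ∈ Set.Ico (τ p.castSucc) (τ p.succ), ∀ i r, A t i r = x p i * D i r) ∧
        (∀ p, Set.InjOn T {i | τ p.castSucc < T i} →
          Set.indicator {i | τ p.castSucc < T i} (x p) ∈
            paretoExtremePoints D {i | τ p.castSucc < T i})) := by
  refine ⟨fun A T h => h.exists_isFixed hD_one hk, fun A T h hfix => ?_⟩
  obtain ⟨N, hN, τ, f, hb⟩ := exists_isBreakpoints (h.time_pos hD_one hk)
  obtain ⟨ρ, hρ, hA⟩ := h.1.isAllocation.exists_shares hD_one
  have hτ := hb.strictMono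
  have hpos : ∀ q, 0 ≤ τ q := fun q => hb.zero ▸ hτ.monotone (Nat.zero_le q)
  have hmem : ∀ q ≤ N, τ q ∈ insert 0 (range T) := fun q hq => by
    rcases Nat.eq_zero_or_pos q with rfl | hq0
    · exact Or.inl hb.zero
    · obtain ⟨i, rfl⟩ := hb.exists_eq q hq0 hq
      exact Or.inr ⟨i, (hb.eq_time i).symm⟩
  have hconst : ∀ q < N, ∀ t ∈ Ico (τ q) (τ (q + 1)), A t = A (τ q) := by
    intro q hq t ht
    refine hfix _ (hmem q hq.le) (τ (q + 1)) ⟨⟨?_, hτ (Nat.lt_succ_self q)⟩, ?_⟩ t ht _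
      ⟨le_rfl, hτ (Nat.lt_succ_self q)⟩
    · obtain ⟨i, hi⟩ := hb.exists_eq (q + 1) (Nat.succ_pos q) hq
      exact ⟨i, by rw [← hi, hb.eq_time]⟩
    · rintro _ ⟨⟨i, rfl⟩, hi⟩
      rw [← hb.eq_time i] at hi ⊢
      exact hτ.monotone (hτ.lt_iff_lt.1 hi)
  -- Since `D i (ρ i) = 1`, this entry is the dominant share.
  let x : ℕ → Fin n → ℝ := fun q i => A (τ q) i (ρ i)
  have hx : ∀ q < N, x q ∈ capacityPolytope D univ := fun q _ => (hA _ (hpos q)).2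
  have hw : ∀ i, k i = ∑ q ∈ Finset.range (f i), (τ (q + 1) - τ q) * x q i := by
    intro i
    have h1 := (h.1.completes i).1.2 (ρ i)
    rw [hρ, mul_one, ← hb.eq_time i] at h1
    rw [← h1]
    have h2 := integral_eq_sum_of_eqOn hτ (f := fun s => A s i (ρ i)) (y := fun q => x q i)
      (M := f i)
      (fun q _ => (h.1.isAllocation.integrable i (ρ i) _ (hpos q)).symm.trans
        (h.1.isAllocation.integrable i (ρ i) _ (hpos (q + 1))))
      (fun q hq t ht => by simp only [hconst q (hq.trans_le (hb.le i)) t ht, x])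
    rwa [hb.zero] at h2
  refine ⟨N, hN, fun q => τ q, fun q => x q, fun q q' hq => hτ hq, hb.zero, ?_, ?_, ?_⟩
  · ext t
    constructor
    · rintro ⟨q, rfl⟩
      exact hmem q (Nat.lt_succ_iff.1 q.2)
    · rintro (rfl | ⟨i, rfl⟩)
      · exact ⟨0, hb.zero⟩
      · exact ⟨⟨f i, Nat.lt_succ_iff.2 (hb.le i)⟩, hb.eq_time i⟩
  · intro p t ht i r
    rw [hconst p p.2 t ht]
    exact (hA _ (hpos p)).1 i r
  · intro p hinj
    have hset : {i | τ (p.castSucc : Fin (N + 1)) < T i} = {i | (p : ℕ) < f i} := by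
      ext i
      simp only [mem_ofPred_eq, Fin.val_castSucc, ← hb.eq_time i, hτ.lt_iff_lt]
    rw [hset] at hinj ⊢
    have hinj' : InjOn f {i | (p : ℕ) < f i} := fun i hi j hj hij =>
      hinj hi hj (by rw [← hb.eq_time, ← hb.eq_time, hij])
    exact ⟨h.indicator_mem_paretoFrontier (fun i r => (hD i r).1) hD_one hk hb hx hw p.2,
      h.indicator_mem_extremePoints (fun i r => (hD i r).1) hD_one hk hb hx hw p.2 hinj'⟩
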